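/- Let $\mathbb{K}$ be a field of characteristic zero (for example $\mathbb{Q}$, $\mathbb{R}$ or $\mathbb{C}$) and let $r\in\mathbb{Z}$. Let $\mathcal{F}_r$ be the space of formal power series $\varphi(x)\in\mathbb{K}[\![x]\!]$ with $\varphi\bigl(x/(x-1)\bigr)=(1-x)^r\varphi(x)$. Let $B_m$ denote the Bernoulli numbers, $\frac{t}{e^t-1}=\sum_{m\ge 0}B_m\frac{t^m}{m!}$. For $\varphi(x)=\sum_{i=0}^\infty\gamma_i x^i\in\mathbb{K}[\![x]\!]$ put $\gamma_i=0$ for $i<0$, and consider, with $k=\lfloor r/2\rfloor$, the relations $$\text{(M}_n)\qquad \gamma_{2n}=\frac{2}{2n+r}\sum_{i=-k}^{n}\binom{2n+r}{2i+r}B_{2n-2i}\,\gamma_{2i+1},$$ $$\text{(I}_n)\qquad \gamma_{2n}=\sum_{i=0}^{n}\frac{2}{2i+r}\binom{-2i-r}{-2n-r}B_{2n-2i}\,\gamma_{2i+1}.$$ 1. Suppose that $r=2k$ is even. Then $\varphi\in\mathcal{F}_r$ if and only if $(\mathrm{M}_n)$ holds for every integer $n\ge\max\{0,1-k\}$ and,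 if $r\le 0$, $\gamma_{1-r}=0$ and, if $r<0$, $(\mathrm{I}_n)$ holds for $0\le n\le -k-1$. Moreover, if $r>0$, then for every choice of $\gamma_1,\gamma_3,\gamma_5,\ldots\in\mathbb{K}$ there is exactly one element of $\mathcal{F}_r$ with these odd coefficients. If $r\le 0$, the coefficient $\gamma_{-r}$ is unconstrained: for every choice of $\gamma_1,\gamma_3,\gamma_5,\ldots\in\mathbb{K}$ with $\gamma_{1-r}=0$ and every choice of $\gamma_{-r}\in\mathbb{K}$ there is exactly one element of $\mathcal{F}_r$ with these coefficients. 2. Suppose that $r=2k+1$ is odd. Then $\varphi\in\mathcal{F}_r$ if and only if $(\mathrm{M}_n)$ holds for every integer $n\ge\max\{0,-k\}$ and, if $r<0$, $(\mathrm{I}_n)$ holds for $0\le n\le -k-1$. Moreover, for every choice of $\gamma_1,\gamma_3,\gamma_5,\ldots\in\mathbb{K}$ there is exactly one element of $\mathcal{F}_r$ with these odd coefficients. -/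

import Mathlib

noncomputable section

open PowerSeries

/-- The power series `x / (x - 1)`. -/
def moebius (K : Type*) [Field K] : K⟦X⟧ := X * (X - 1)⁻¹

/-- `x / (x - 1)` has no constant term, so it can be substituted into any power series. -/
theorem hasSubst_moebius (K : Type*) [Field K] : PowerSeries.HasSubst (moebius K) :=
  PowerSeries.HasSubst.of_constantCoeff_zero' (by simp [moebius])

/-- The power series `1 - x` as a unit, so that `(1 - x) ^ r` makes sense for `r : ℤ`. -/
def oneSubX (K : Type*) [Field K] : K⟦X⟧ˣ where
  val := 1 - X
  inv := (1 - X)⁻¹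
  val_inv := PowerSeries.mul_inv_cancel _ (by simp)
  inv_val := PowerSeries.inv_mul_cancel _ (by simp)

/-- The space `F_r` of formal power series `φ` with `φ (x / (x - 1)) = (1 - x) ^ r * φ (x)`. -/
def FSpace (K : Type*) [Field K] (r : ℤ) : Submodule K K⟦X⟧ where
  carrier := {φ | φ.subst (moebius K) = ((oneSubX K ^ r : K⟦X⟧ˣ) : K⟦X⟧) * φ}
  add_mem' := by
    intro a b ha hb
    simp only [Set.mem_ofPred_eq] at ha hb ⊢
    rw [PowerSeries.subst_add (hasSubst_moebius K), ha, hb, mul_add]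
  zero_mem' := by
    simp only [Set.mem_ofPred_eq, mul_zero]
    rw [← PowerSeries.coe_substAlgHom (hasSubst_moebius K), map_zero]
  smul_mem' := by
    intro c a ha
    simp only [Set.mem_ofPred_eq] at ha ⊢
    rw [PowerSeries.subst_smul (hasSubst_moebius K), ha, mul_smul_comm]

/-- The coefficient `γ_i` of `x ^ i` in `φ`, for `i : ℤ`, with `γ_i = 0` for `i < 0`. -/
def gammaCoeff {K : Type*} [Field K] (φ : K⟦X⟧) (i : ℤ) : K :=
  if 0 ≤ i then PowerSeries.coeff i.toNat φ else 0

/-- For `r = 2k` or `r = 2k + 1`, the relation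
`γ_{2n} = 2 / (2n + r) * ∑_{i = -k}^{n} C(2n + r, 2i + r) B_{2n - 2i} γ_{2i + 1}`.
It is used only for `n` with `0 < 2n + r`; all arguments of `Int.toNat` are then nonnegative. -/
def MainRelation {K : Type*} [Field K] (φ : K⟦X⟧) (r k n : ℤ) : Prop :=
  gammaCoeff φ (2 * n) =
    2 / (2 * (n : K) + (r : K)) *
      ∑ i ∈ Finset.Icc (-k) n,
        (((2 * n + r).toNat.choose (2 * i + r).toNat : ℕ) : K) *
          ((bernoulli (2 * n - 2 * i).toNat : ℚ) : K) * gammaCoeff φ (2 * i + 1)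

/-- The relation
`γ_{2n} = ∑_{i = 0}^{n} 2 / (2i + r) * C(-2i - r, -2n - r) B_{2n - 2i} γ_{2i + 1}`.
It is used only for `n` with `0 ≤ n` and `2n + r < 0`; all arguments of `Int.toNat` are then
nonnegative. -/
def InitialRelation {K : Type*} [Field K] (φ : K⟦X⟧) (r n : ℤ) : Prop :=
  gammaCoeff φ (2 * n) =
    ∑ i ∈ Finset.Icc 0 n,
      2 / (2 * (i : K) + (r : K)) *
        (((-2 * i - r).toNat.choose (-2 * n - r).toNat : ℕ) : K) *
          ((bernoulli (2 * n - 2 * i).toNat : ℚ) : K) * gammaCoeff φ (2 * i + 1)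

end

/-! ### Coefficient form of the functional equation, with binomial weights -/

section

open PowerSeries

variable {K : Type*} [Field K]

/-! Comparing coefficients in `φ = (1 - x)^(-r) φ(x/(x-1))` gives a linear system for the `γ_i` with
binomial weights, which splits by the sign of `n + r`. For `n + r > 0` the weight is `C(n+r-1,
i+r-1)`, zero when `i + r ≤ 0`; for `n + r ≤ 0` it is, up to sign, `C(-r-i, n-i)`. Factorial
rescaling turns both halves into `A + B = (A - B) e^t`, where `A` carries the even and `B` the odd
coefficients; the second half holds only modulo `t^(1-r)` (`mem_FSpace_iff_exp`). Solving for `A`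
gives `t A = 2 E B` with `E = (t/2) coth(t/2)`, the source of the Bernoulli numbers
(`coeff_exp_relation_iff`). As `E` is even, half of the degrees are trivial. The others are exactly
(M_n) for `2n + r > 0`, (I_n) for `2n + r < 0`, and, in degree 0 of the first half, `γ_{1-r} = 0`
for even `r` (`mem_FSpace_iff_relations`). Each relation expresses one even coefficient through odd
ones, and only `γ_{-r}` is never reached; hence existence and uniqueness. -/

theorem coeff_mul_subst {a : K⟦X⟧} (ha : constantCoeff a = 0) (V φ : K⟦X⟧) (n : ℕ) :
    coeff n (V * φ.subst a) =
      ∑ i ∈ Finset.range (n + 1), coeff i φ * coeff n (V * a ^ i) := by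
  have key : ∀ q ≤ n, coeff q (φ.subst a) =
      ∑ i ∈ Finset.range (n + 1), coeff i φ * coeff q (a ^ i) := by
    intro q hq
    rw [coeff_subst' (HasSubst.of_constantCoeff_zero' ha)]
    refine finsum_eq_sum_of_support_subset _ fun i hi => ?_
    simp only [Function.mem_support, smul_eq_mul, ne_eq, mul_eq_zero, not_or] at hi
    simp only [Finset.coe_range, Set.mem_Iio]
    by_contra! h
    -- `a ^ i` has order at least `i`, so only `i ≤ q` contribute.
    exact hi.2 (coeff_of_lt_order _ (lt_of_lt_of_le (by exact_mod_cast (by omega : q < i))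
      (le_order_pow_of_constantCoeff_eq_zero i ha)))
  rw [coeff_mul]
  simp_rw [coeff_mul n V, Finset.mul_sum]
  rw [Finset.sum_comm]
  refine Finset.sum_congr rfl fun x hx => ?_
  rw [key x.2 (by have := Finset.HasAntidiagonal.mem_antidiagonal.mp hx; omega), Finset.mul_sum]
  exact Finset.sum_congr rfl fun i _ => by ring

theorem moebius_eq : moebius K = -(X * (((oneSubX K)⁻¹ : K⟦X⟧ˣ) : K⟦X⟧)) := by
  have h : (X - 1 : K⟦X⟧)⁻¹ = -(1 - X)⁻¹ := by
    rw [PowerSeries.inv_eq_iff_mul_eq_one (by simp)]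
    have := PowerSeries.mul_inv_cancel (1 - X : K⟦X⟧) (by simp)
    linear_combination this
  rw [moebius, h, mul_neg]
  rfl

theorem mem_FSpace_iff_coeff (φ : K⟦X⟧) (r : ℤ) :
    φ ∈ FSpace K r ↔ ∀ n, coeff n φ = ∑ i ∈ Finset.range (n + 1),
      coeff i φ * ((-1) ^ i *
        coeff (n - i) ((oneSubX K ^ (-((i : ℤ) + r)) : K⟦X⟧ˣ) : K⟦X⟧)) := by
  have h1 : φ ∈ FSpace K r ↔
      φ = ((oneSubX K ^ (-r) : K⟦X⟧ˣ) : K⟦X⟧) * φ.subst (moebius K) := by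
    change φ.subst (moebius K) = ((oneSubX K ^ r : K⟦X⟧ˣ) : K⟦X⟧) * φ ↔ _
    rw [zpow_neg, Units.eq_inv_mul_iff_mul_eq, eq_comm]
  rw [h1, PowerSeries.ext_iff]
  refine forall_congr' fun n => ?_
  rw [coeff_mul_subst (by simp [moebius])]
  refine Eq.congr_right (Finset.sum_congr rfl fun i hi => ?_)
  have h2 : ((oneSubX K ^ (-r) : K⟦X⟧ˣ) : K⟦X⟧) * moebius K ^ i =
      C ((-1) ^ i) * (X ^ i * ((oneSubX K ^ (-((i : ℤ) + r)) : K⟦X⟧ˣ) : K⟦X⟧)) := by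
    rw [moebius_eq, neg_pow, mul_pow, neg_add_rev, zpow_add, zpow_neg _ (i : ℤ), zpow_natCast,
      Units.val_mul, ← inv_pow, Units.val_pow_eq_pow_val]
    simp only [map_pow, map_neg, map_one]
    ring
  rw [h2, coeff_C_mul, coeff_X_pow_mul', if_pos (by simpa [Nat.lt_succ_iff] using hi)]

theorem coeff_oneSubX_pow (m j : ℕ) :
    coeff j ((oneSubX K ^ (m : ℤ) : K⟦X⟧ˣ) : K⟦X⟧) = (-1) ^ j * (m.choose j : K) := by
  have h : ((oneSubX K ^ (m : ℤ) : K⟦X⟧ˣ) : K⟦X⟧) =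
      rescale (-1 : K) (((1 + Polynomial.X : Polynomial K) ^ m : Polynomial K) : K⟦X⟧) := by
    rw [zpow_natCast, Units.val_pow_eq_pow_val, Polynomial.coe_pow, Polynomial.coe_add,
      Polynomial.coe_one, Polynomial.coe_X, map_pow, map_add, map_one, rescale_X]
    simp [oneSubX, sub_eq_add_neg]
  rw [h, coeff_rescale, Polynomial.coeff_coe, Polynomial.coeff_one_add_X_pow]

theorem coeff_oneSubX_neg_pow (m j : ℕ) :
    coeff j ((oneSubX K ^ (-((m : ℤ) + 1)) : K⟦X⟧ˣ) : K⟦X⟧) = ((m + j).choose j : K) := by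
  have h : (oneSubX K ^ (-((m : ℤ) + 1)) : K⟦X⟧ˣ) = invOneSubPow K (m + 1) := by
    rw [zpow_neg, _root_.inv_eq_iff_mul_eq_one]
    ext1
    have : (oneSubX K : K⟦X⟧) = 1 - X := rfl
    rw [show (m : ℤ) + 1 = ((m + 1 : ℕ) : ℤ) by push_cast; rfl, zpow_natCast, Units.val_mul,
      Units.val_pow_eq_pow_val, invOneSubPow_val_succ_eq_mk_add_choose, mul_comm, this,
      mk_add_choose_mul_one_sub_pow_eq_one]
    rfl
  rw [h, invOneSubPow_val_succ_eq_mk_add_choose, coeff_mk, Nat.choose_symm_add]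

end

/-! ### From the exponential relation to Bernoulli numbers -/

section

open PowerSeries

variable {K : Type*} [Field K] [CharZero K]

/-- The even power series `∑ B_{2m} t^{2m} / (2m)! = (t / 2) coth (t / 2)`. -/
noncomputable def evenBernoulliSeries (K : Type*) [Field K] : K⟦X⟧ :=
  mk fun m => if Even m then ((bernoulli m : ℚ) : K) / (m.factorial : K) else 0

/-- The only nonzero Bernoulli number of odd index is `B_1 = -1/2`, and adding `t/2` cancels it. -/
theorem two_mul_evenBernoulliSeries :
    2 * evenBernoulliSeries K = 2 * bernoulliPowerSeries K + X := by
  ext n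
  have h2 : ∀ f : K⟦X⟧, coeff n (2 * f) = 2 * coeff n f := fun f => by
    rw [two_mul, map_add, two_mul]
  rw [map_add, h2, h2, evenBernoulliSeries, bernoulliPowerSeries, coeff_mk, coeff_mk, coeff_X]
  rcases Nat.even_or_odd n with h | h
  · have : n ≠ 1 := by rintro rfl; simp at h
    simp [h, this]
  · have h' : ¬ Even n := by simpa using h
    by_cases h1 : n = 1
    · subst h1
      norm_num
    · have : 1 < n := by have := h.pos; omega
      simp [h', h1, bernoulli_eq_zero_of_odd h this]

theorem evenBernoulliSeries_mul_exp :
    2 * evenBernoulliSeries K * (exp K - 1) = X * (exp K + 1) := by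
  rw [two_mul_evenBernoulliSeries]
  linear_combination 2 * bernoulliPowerSeries_mul_exp_sub_one K

/-- The two differences agree up to the unit `-(e^t - 1)/t`, so they are divisible by the same
powers of `t`. The truncated form is needed for the lower half of the system. -/
theorem coeff_exp_relation_iff (A B : K⟦X⟧) (m : ℕ) :
    (∀ s < m, coeff s (A + B) = coeff s ((A - B) * exp K)) ↔
      ∀ s < m, coeff s (X * A) = coeff s (2 * evenBernoulliSeries K * B) := by
  have hdvd : ∀ f g : K⟦X⟧, (∀ s < m, coeff s f = coeff s g) ↔ X ^ m ∣ f - g := by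
    intro f g
    simp only [X_pow_dvd_iff, map_sub, sub_eq_zero]
  rw [hdvd, hdvd]
  obtain ⟨u, hu⟩ : X ∣ exp K - 1 := by
    rw [X_dvd_iff]; simp
  have hu0 : IsUnit u := by
    rw [isUnit_iff_constantCoeff]
    have := congrArg (coeff 1) hu
    rw [coeff_succ_X_mul] at this
    simp at this
    simp [← this]
  have key : (A + B - (A - B) * exp K) = -u * (X * A - 2 * evenBernoulliSeries K * B) := by
    apply mul_left_cancel₀ (X_ne_zero (R := K))
    linear_combination (-(X * A - 2 * evenBernoulliSeries K * B)) * hu -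
      B * evenBernoulliSeries_mul_exp (K := K)
  rw [key]
  exact (hu0.neg).dvd_mul_left

end

/-! ### Splitting the system at `n + r = 0` and rescaling by factorials -/

section

open PowerSeries

variable {K : Type*} [Field K]

@[simp]
theorem gammaCoeff_natCast (φ : K⟦X⟧) (i : ℕ) : gammaCoeff φ i = coeff i φ := by
  simp [gammaCoeff]

theorem gammaCoeff_of_neg (φ : K⟦X⟧) {i : ℤ} (hi : i < 0) : gammaCoeff φ i = 0 := by
  simp [gammaCoeff, hi]

/-- The exponential generating function `∑ γ_{l+1-r} t^l / l!`, restricted to even `l + 1 - r`. -/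
noncomputable def upperEven (φ : K⟦X⟧) (r : ℤ) : K⟦X⟧ :=
  mk fun l => if Even ((l : ℤ) + 1 - r) then gammaCoeff φ (l + 1 - r) / (l.factorial : K) else 0

/-- The exponential generating function `∑ γ_{l+1-r} t^l / l!`, restricted to odd `l + 1 - r`. -/
noncomputable def upperOdd (φ : K⟦X⟧) (r : ℤ) : K⟦X⟧ :=
  mk fun l => if Even ((l : ℤ) + 1 - r) then 0 else gammaCoeff φ (l + 1 - r) / (l.factorial : K)

/-- The series `∑ (R - s)! γ_s t^s`, restricted to even `s`; only `s ≤ R` is meaningful. -/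
noncomputable def lowerEven (φ : K⟦X⟧) (R : ℕ) : K⟦X⟧ :=
  mk fun s => if Even s then coeff s φ * ((R - s).factorial : K) else 0

/-- The series `-∑ (R - s)! γ_s t^s`, restricted to odd `s`; only `s ≤ R` is meaningful. -/
noncomputable def lowerOdd (φ : K⟦X⟧) (R : ℕ) : K⟦X⟧ :=
  mk fun s => if Even s then 0 else -(coeff s φ * ((R - s).factorial : K))

theorem coeff_upper_add (φ : K⟦X⟧) (r : ℤ) (s : ℕ) :
    coeff s (upperEven φ r + upperOdd φ r) = gammaCoeff φ (s + 1 - r) / (s.factorial : K) := by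
  rw [upperEven, upperOdd, map_add, coeff_mk, coeff_mk]
  split_ifs <;> simp

theorem coeff_lower_add (φ : K⟦X⟧) (R n : ℕ) :
    coeff n (lowerEven φ R + lowerOdd φ R) =
      (-1) ^ n * (coeff n φ * ((R - n).factorial : K)) := by
  rw [lowerEven, lowerOdd, map_add, coeff_mk, coeff_mk]
  rcases Nat.even_or_odd n with he | ho
  · simp [he, he.neg_one_pow]
  · simp [Nat.not_even_iff_odd.mpr ho, ho.neg_one_pow]

variable [CharZero K]

theorem coeff_mul_exp (f : K⟦X⟧) (s : ℕ) :
    coeff s (f * exp K) =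
      ∑ l ∈ Finset.range (s + 1), coeff l f * (1 / ((s - l).factorial : K)) := by
  rw [coeff_mul, Finset.Nat.sum_antidiagonal_eq_sum_range_succ_mk]
  simp [coeff_exp]

theorem choose_eq_factorial_div {s l : ℕ} (h : l ≤ s) :
    (s.choose l : K) = (s.factorial : K) / ((l.factorial : K) * ((s - l).factorial : K)) :=
  Nat.cast_choose K h

theorem upper_sum_eq (φ : K⟦X⟧) (r : ℤ) (s n : ℕ) (h : (n : ℤ) + r = s + 1) :
    ∑ i ∈ Finset.range (n + 1), coeff i φ * ((-1) ^ i *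
        coeff (n - i) ((oneSubX K ^ (-((i : ℤ) + r)) : K⟦X⟧ˣ) : K⟦X⟧)) =
      s.factorial * coeff s ((upperEven φ r - upperOdd φ r) * exp K) := by
  rw [coeff_mul_exp, Finset.mul_sum]
  -- For `i + r ≤ 0` the factor is a polynomial of degree `-(i + r) < n - i`, so these terms vanish
  -- and the upper half decouples from the lower one.
  have hlow : ∀ i ∈ Finset.range (n + 1), coeff i φ * ((-1) ^ i *
        coeff (n - i) ((oneSubX K ^ (-((i : ℤ) + r)) : K⟦X⟧ˣ) : K⟦X⟧)) ≠ 0 →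
        1 ≤ (i : ℤ) + r := by
    intro i hi hne
    by_contra! hlt
    apply hne
    rw [Finset.mem_range] at hi
    obtain ⟨b, hb⟩ : ∃ b : ℕ, -((i : ℤ) + r) = b := ⟨(-((i : ℤ) + r)).toNat, by omega⟩
    rw [hb, coeff_oneSubX_pow, Nat.choose_eq_zero_of_lt (by omega)]
    simp
  -- Reindexing by `l = i + r - 1` matches nonzero terms only: small `i` drop out when `r ≤ 0`,
  -- small `l` when `r > 1`.
  refine Finset.sum_bij_ne_zero (fun i _ _ => ((i : ℤ) + r - 1).toNat) ?_ ?_ ?_ ?_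
  · intro i hi hne
    have := hlow i hi hne
    rw [Finset.mem_range] at hi ⊢
    omega
  · intro i hi hne j hj hne' hij
    have := hlow i hi hne
    have := hlow j hj hne'
    omega
  · intro l hl hne
    have hl' : 0 ≤ (l : ℤ) + 1 - r := by
      by_contra! hlt
      apply hne
      simp [upperEven, upperOdd, gammaCoeff_of_neg φ hlt]
    obtain ⟨i, hi⟩ : ∃ i : ℕ, (l : ℤ) + 1 - r = i := ⟨((l : ℤ) + 1 - r).toNat, by omega⟩
    rw [Finset.mem_range] at hl
    refine ⟨i, by rw [Finset.mem_range]; omega, ?_, by omega⟩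
    rw [show -((i : ℤ) + r) = -((l : ℤ) + 1) by omega, coeff_oneSubX_neg_pow]
    have hc : ((l + (n - i)).choose (n - i) : K) ≠ 0 := by
      exact_mod_cast (Nat.choose_pos (by omega)).ne'
    have hφ : coeff i φ ≠ 0 := by
      intro h0
      apply hne
      simp [upperEven, upperOdd, hi, h0]
    simp [hc, hφ]
  · intro i hi hne
    have := hlow i hi hne
    obtain ⟨l, hl⟩ : ∃ l : ℕ, (i : ℤ) + r - 1 = l := ⟨((i : ℤ) + r - 1).toNat, by omega⟩
    rw [Finset.mem_range] at hi
    have hls : l ≤ s := by omega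
    rw [hl, Int.toNat_natCast, show -((i : ℤ) + r) = -((l : ℤ) + 1) by omega,
      coeff_oneSubX_neg_pow, show l + (n - i) = s by omega, show n - i = s - l by omega,
      Nat.choose_symm hls, choose_eq_factorial_div hls]
    have hli : (l : ℤ) + 1 - r = i := by omega
    rw [upperEven, upperOdd, map_sub, coeff_mk, coeff_mk, hli, gammaCoeff_natCast]
    rcases Nat.even_or_odd i with he | ho
    · rw [if_pos (by exact_mod_cast he), if_pos (by exact_mod_cast he), he.neg_one_pow]
      field_simp
      ring
    · have he : ¬ Even (i : ℤ) := by simpa using ho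
      rw [if_neg he, if_neg he, ho.neg_one_pow]
      field_simp
      ring

theorem coeff_upper_mul_exp_of_lt (φ : K⟦X⟧) (r : ℤ) (s : ℕ) (h : (s : ℤ) + 1 < r) :
    coeff s ((upperEven φ r - upperOdd φ r) * exp K) = 0 := by
  rw [coeff_mul_exp]
  refine Finset.sum_eq_zero fun l hl => ?_
  rw [Finset.mem_range] at hl
  simp [upperEven, upperOdd, gammaCoeff_of_neg φ (show (l : ℤ) + 1 - r < 0 by omega)]

/-- `(R-n)! C(R-i, n-i) = (R-i)!/(n-i)!` makes the sum a convolution with `e^t`. The sign `(-1)^n`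
accounts for the minus sign in `lowerOdd`. -/
theorem lower_sum_eq (φ : K⟦X⟧) (R n : ℕ) (h : n ≤ R) :
    (R - n).factorial * ∑ i ∈ Finset.range (n + 1), coeff i φ * ((-1) ^ i *
        coeff (n - i) ((oneSubX K ^ (-((i : ℤ) + (-(R : ℤ)))) : K⟦X⟧ˣ) : K⟦X⟧)) =
      (-1) ^ n * coeff n ((lowerEven φ R - lowerOdd φ R) * exp K) := by
  rw [coeff_mul_exp, Finset.mul_sum, Finset.mul_sum]
  refine Finset.sum_congr rfl fun i hi => ?_
  rw [Finset.mem_range] at hi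
  have hAB : coeff i (lowerEven φ R - lowerOdd φ R) = coeff i φ * ((R - i).factorial : K) := by
    rw [lowerEven, lowerOdd, map_sub, coeff_mk, coeff_mk]
    split_ifs <;> simp
  have hsign : (-1 : K) ^ i * (-1) ^ (n - i) = (-1) ^ n := by
    rw [← pow_add, show i + (n - i) = n by omega]
  rw [hAB, show -((i : ℤ) + (-(R : ℤ))) = ((R - i : ℕ) : ℤ) by omega, coeff_oneSubX_pow,
    choose_eq_factorial_div (by omega), show R - i - (n - i) = R - n by omega, ← hsign]
  have hs : ((R - n).factorial : K) ≠ 0 := by exact_mod_cast (R - n).factorial_ne_zero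
  field_simp

theorem mem_FSpace_iff_exp (φ : K⟦X⟧) (r : ℤ) :
    φ ∈ FSpace K r ↔
      (∀ s : ℕ, coeff s (upperEven φ r + upperOdd φ r) =
        coeff s ((upperEven φ r - upperOdd φ r) * exp K)) ∧
      ∀ R : ℕ, r = -(R : ℤ) → ∀ n < R + 1, coeff n (lowerEven φ R + lowerOdd φ R) =
        coeff n ((lowerEven φ R - lowerOdd φ R) * exp K) := by
  have hup : ∀ s n : ℕ, (n : ℤ) + r = s + 1 →
      ((coeff n φ = ∑ i ∈ Finset.range (n + 1), coeff i φ * ((-1) ^ i *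
        coeff (n - i) ((oneSubX K ^ (-((i : ℤ) + r)) : K⟦X⟧ˣ) : K⟦X⟧))) ↔
      coeff s (upperEven φ r + upperOdd φ r) =
        coeff s ((upperEven φ r - upperOdd φ r) * exp K)) := by
    intro s n h
    have hs : (s.factorial : K) ≠ 0 := by exact_mod_cast s.factorial_ne_zero
    rw [upper_sum_eq φ r s n h, coeff_upper_add, show (s : ℤ) + 1 - r = n by omega,
      gammaCoeff_natCast, div_eq_iff hs, mul_comm]
  have hlow : ∀ R n : ℕ, n < R + 1 → r = -(R : ℤ) →
      ((coeff n φ = ∑ i ∈ Finset.range (n + 1), coeff i φ * ((-1) ^ i *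
        coeff (n - i) ((oneSubX K ^ (-((i : ℤ) + r)) : K⟦X⟧ˣ) : K⟦X⟧))) ↔
      coeff n (lowerEven φ R + lowerOdd φ R) =
        coeff n ((lowerEven φ R - lowerOdd φ R) * exp K)) := by
    rintro R n h rfl
    have hs : ((R - n).factorial : K) ≠ 0 := by exact_mod_cast (R - n).factorial_ne_zero
    have hsq : (-1 : K) ^ n * (-1) ^ n = 1 := by rw [← mul_pow]; simp
    rw [coeff_lower_add, ← mul_right_inj' hs, lower_sum_eq φ R n (by omega)]
    constructor
    · intro e
      linear_combination (-1) ^ n * e +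
        coeff n ((lowerEven φ R - lowerOdd φ R) * exp K) * hsq
    · intro e
      linear_combination (-1) ^ n * e - (coeff n φ * ((R - n).factorial : K)) * hsq
  rw [mem_FSpace_iff_coeff]
  constructor
  · intro H
    refine ⟨fun s => ?_, fun R hR n hn => (hlow R n hn hR).1 (H n)⟩
    rcases lt_or_ge ((s : ℤ) + 1) r with h | h
    · rw [coeff_upper_mul_exp_of_lt φ r s h, coeff_upper_add, gammaCoeff_of_neg φ (by omega),
        zero_div]
    · exact (hup s ((s : ℤ) + 1 - r).toNat (by omega)).1 (H _)
  · rintro ⟨H1, H2⟩ n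
    rcases lt_or_ge 0 ((n : ℤ) + r) with h | h
    · exact (hup ((n : ℤ) + r - 1).toNat n (by omega)).2 (H1 _)
    · exact (hlow (-r).toNat n (by omega) (by omega)).2 (H2 _ (by omega) n (by omega))

theorem mem_FSpace_iff_bernoulli (φ : K⟦X⟧) (r : ℤ) :
    φ ∈ FSpace K r ↔
      (∀ s : ℕ, coeff s (X * upperEven φ r) =
        coeff s (2 * evenBernoulliSeries K * upperOdd φ r)) ∧
      ∀ R : ℕ, r = -(R : ℤ) → ∀ n < R + 1, coeff n (X * lowerEven φ R) =
        coeff n (2 * evenBernoulliSeries K * lowerOdd φ R) := by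
  rw [mem_FSpace_iff_exp]
  refine and_congr ⟨fun H s => ?_, fun H s => ?_⟩ (forall₂_congr fun R _ => ?_)
  · exact (coeff_exp_relation_iff _ _ (s + 1)).1 (fun t _ => H t) s (Nat.lt_succ_self s)
  · exact (coeff_exp_relation_iff _ _ (s + 1)).2 (fun t _ => H t) s (Nat.lt_succ_self s)
  · exact coeff_exp_relation_iff _ _ (R + 1)

end

/-! ### Reading off the relations degree by degree -/

section

open PowerSeries

variable {K : Type*} [Field K]

theorem coeff_two_mul_evenBernoulliSeries_mul (f : K⟦X⟧) (s : ℕ) :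
    coeff s (2 * evenBernoulliSeries K * f) =
      ∑ l ∈ Finset.range (s + 1), 2 * (coeff l f * coeff (s - l) (evenBernoulliSeries K)) := by
  rw [mul_assoc, two_mul, map_add, ← two_mul, mul_comm (evenBernoulliSeries K), coeff_mul,
    Finset.Nat.sum_antidiagonal_eq_sum_range_succ_mk, Finset.mul_sum]

theorem coeff_evenBernoulliSeries_of_even {m : ℕ} (h : Even m) :
    coeff m (evenBernoulliSeries K) = ((bernoulli m : ℚ) : K) / (m.factorial : K) := by
  simp [evenBernoulliSeries, h]

theorem coeff_evenBernoulliSeries_of_not_even {m : ℕ} (h : ¬ Even m) :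
    coeff m (evenBernoulliSeries K) = 0 := by
  simp only [evenBernoulliSeries, coeff_mk, if_neg h]

theorem mainRelation_of_neg (φ : K⟦X⟧) {r k n : ℤ} (hn : n < 0) : MainRelation φ r k n := by
  rw [MainRelation, gammaCoeff_of_neg φ (by omega), Finset.sum_eq_zero, mul_zero]
  intro i hi
  rw [Finset.mem_Icc] at hi
  rw [gammaCoeff_of_neg φ (by omega), mul_zero]

variable [CharZero K]

theorem mainRelation_iff (φ : K⟦X⟧) {r k n : ℤ} {s : ℕ} (hk : r = 2 * k ∨ r = 2 * k + 1)
    (h : 2 * n + r = s + 1) :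
    MainRelation φ r k n ↔ coeff (s + 1) (X * upperEven φ r) =
      coeff (s + 1) (2 * evenBernoulliSeries K * upperOdd φ r) := by
  have hs : (s.factorial : K) ≠ 0 := by exact_mod_cast s.factorial_ne_zero
  have hs1 : (s : K) + 1 ≠ 0 := by exact_mod_cast s.succ_ne_zero
  have hcast : 2 * (n : K) + (r : K) = s + 1 := by exact_mod_cast congrArg (Int.cast (R := K)) h
  have hsum : 2 / (2 * (n : K) + (r : K)) *
      ∑ i ∈ Finset.Icc (-k) n,
        (((2 * n + r).toNat.choose (2 * i + r).toNat : ℕ) : K) *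
          ((bernoulli (2 * n - 2 * i).toNat : ℚ) : K) * gammaCoeff φ (2 * i + 1) =
      coeff (s + 1) (2 * evenBernoulliSeries K * upperOdd φ r) * s.factorial := by
    rw [coeff_two_mul_evenBernoulliSeries_mul, Finset.sum_mul, Finset.mul_sum]
    refine Finset.sum_of_injOn (fun i => (2 * i + r).toNat) ?_ ?_ ?_ ?_
    · intro i hi j hj hij
      simp only [Finset.coe_Icc, Set.mem_Icc] at hi hj
      simp only at hij
      omega
    · intro i hi
      simp only [Finset.coe_Icc, Set.mem_Icc, Finset.coe_range, Set.mem_Iio] at hi ⊢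
      omega
    -- The indices `l` not of the form `2i + r` meet an odd-index coefficient of the even series.
    · intro l hl hne
      rw [Finset.mem_range] at hl
      have hodd : ¬ Even (s + 1 - l) := by
        rintro ⟨d, hd⟩
        refine hne ⟨n - d, ?_, ?_⟩
        · simp only [Finset.coe_Icc, Set.mem_Icc]
          omega
        · simp only
          omega
      rw [coeff_evenBernoulliSeries_of_not_even hodd]
      simp
    · intro i hi
      rw [Finset.mem_Icc] at hi
      obtain ⟨l, hl⟩ : ∃ l : ℕ, 2 * i + r = l := ⟨(2 * i + r).toNat, by omega⟩
      have hle : l ≤ s + 1 := by omega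
      have hev : Even (s + 1 - l) := ⟨(n - i).toNat, by omega⟩
      have hnot : ¬ Even (2 * i + 1) := by simp
      rw [coeff_evenBernoulliSeries_of_even (by rw [hl]; exact hev), hl, Int.toNat_natCast, upperOdd,
        coeff_mk, show (l : ℤ) + 1 - r = 2 * i + 1 by omega, if_neg hnot, hcast, h,
        show ((s : ℤ) + 1).toNat = s + 1 by omega,
        show (2 * n - 2 * i).toNat = s + 1 - l by omega, choose_eq_factorial_div hle,
        Nat.factorial_succ s]
      push_cast
      field_simp
  rw [MainRelation, hsum, coeff_succ_X_mul, upperEven, coeff_mk,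
    show (s : ℤ) + 1 - r = 2 * n by omega, if_pos (even_two_mul n), div_eq_iff hs]

omit [CharZero K] in
theorem upper_coeff_of_not_even (φ : K⟦X⟧) {r : ℤ} {s : ℕ} (h : ¬ Even ((s : ℤ) + 1 - r)) :
    coeff (s + 1) (X * upperEven φ r) =
      coeff (s + 1) (2 * evenBernoulliSeries K * upperOdd φ r) := by
  rw [coeff_succ_X_mul, upperEven, coeff_mk, if_neg h, coeff_two_mul_evenBernoulliSeries_mul]
  refine (Finset.sum_eq_zero fun l hl => ?_).symm
  rw [Finset.mem_range] at hl
  by_cases hev : Even (s + 1 - l)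
  · have : Even ((l : ℤ) + 1 - r) := by
      simp only [Int.even_iff, Nat.even_iff] at *
      omega
    simp [upperOdd, this]
  · rw [coeff_evenBernoulliSeries_of_not_even hev]
    simp

/-- The left side has no constant term, while the right side has constant term twice that of
`upperOdd`. -/
theorem upper_coeff_zero_iff (φ : K⟦X⟧) (r : ℤ) :
    coeff 0 (X * upperEven φ r) = coeff 0 (2 * evenBernoulliSeries K * upperOdd φ r) ↔
      (Even r → gammaCoeff φ (1 - r) = 0) := by
  rw [coeff_two_mul_evenBernoulliSeries_mul, coeff_zero_X_mul]
  have : Even (1 - r) ↔ ¬ Even r := by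
    simp only [Int.even_iff]; omega
  by_cases h : Even r
  · simp [upperOdd, this, h, evenBernoulliSeries, eq_comm (a := (0 : K))]
  · simp [upperOdd, this, h]

theorem initialRelation_iff (φ : K⟦X⟧) {R n : ℕ} (h : 2 * n + 1 ≤ R) :
    InitialRelation φ (-(R : ℤ)) n ↔ coeff (2 * n + 1) (X * lowerEven φ R) =
      coeff (2 * n + 1) (2 * evenBernoulliSeries K * lowerOdd φ R) := by
  have hs : ((R - 2 * n).factorial : K) ≠ 0 := by exact_mod_cast (R - 2 * n).factorial_ne_zero
  have hsum : (∑ i ∈ Finset.Icc (0 : ℤ) n,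
      2 / (2 * (i : K) + ((-(R : ℤ) : ℤ) : K)) *
        (((-2 * i - -(R : ℤ)).toNat.choose (-2 * (n : ℤ) - -(R : ℤ)).toNat : ℕ) : K) *
          ((bernoulli (2 * (n : ℤ) - 2 * i).toNat : ℚ) : K) * gammaCoeff φ (2 * i + 1)) *
        (R - 2 * n).factorial =
      coeff (2 * n + 1) (2 * evenBernoulliSeries K * lowerOdd φ R) := by
    rw [coeff_two_mul_evenBernoulliSeries_mul, Finset.sum_mul]
    refine Finset.sum_of_injOn (fun i => (2 * i + 1).toNat) ?_ ?_ ?_ ?_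
    · intro i hi j hj hij
      simp only [Finset.coe_Icc, Set.mem_Icc] at hi hj
      simp only at hij
      omega
    · intro i hi
      simp only [Finset.coe_Icc, Set.mem_Icc, Finset.coe_range, Set.mem_Iio] at hi ⊢
      omega
    · intro l hl hne
      rw [Finset.mem_range] at hl
      have hodd : ¬ Even (2 * n + 1 - l) := by
        rintro ⟨d, hd⟩
        refine hne ⟨n - d, ?_, ?_⟩
        · simp only [Finset.coe_Icc, Set.mem_Icc]
          omega
        · simp only
          omega
      rw [coeff_evenBernoulliSeries_of_not_even hodd]
      simp
    · intro i hi
      rw [Finset.mem_Icc] at hi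
      lift i to ℕ using hi.1
      have hin : i ≤ n := by omega
      -- With `m + 1 = R - 2i`, the factor `2/(2i + r) = -2/(m + 1)` turns `(m + 1)!` from the
      -- binomial into `m!` and supplies the sign of `lowerOdd`.
      obtain ⟨m, hm⟩ : ∃ m, R = 2 * i + 1 + m := ⟨R - (2 * i + 1), by omega⟩
      have hev : Even (2 * n + 1 - (2 * i + 1)) := ⟨n - i, by omega⟩
      have hnot : ¬ Even (2 * i + 1) := by simp
      have hc : 2 * ((i : ℤ) : K) + ((-(R : ℤ) : ℤ) : K) = -((m : K) + 1) := by
        rw [hm]; push_cast; ring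
      have hm1 : (m : K) + 1 ≠ 0 := by exact_mod_cast m.succ_ne_zero
      rw [show (2 * (i : ℤ) + 1).toNat = 2 * i + 1 by omega,
        coeff_evenBernoulliSeries_of_even hev, lowerOdd, coeff_mk, if_neg hnot, hc,
        show 2 * (i : ℤ) + 1 = ((2 * i + 1 : ℕ) : ℤ) by push_cast; rfl, gammaCoeff_natCast,
        show (-2 * (i : ℤ) - -(R : ℤ)).toNat = m + 1 by omega,
        show (-2 * (n : ℤ) - -(R : ℤ)).toNat = R - 2 * n by omega,
        show (2 * (n : ℤ) - 2 * (i : ℤ)).toNat = 2 * n + 1 - (2 * i + 1) by omega,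
        choose_eq_factorial_div (by omega), show m + 1 - (R - 2 * n) = 2 * n + 1 - (2 * i + 1) by omega,
        show R - (2 * i + 1) = m by omega, Nat.factorial_succ m]
      push_cast
      field_simp
  rw [← hsum, coeff_succ_X_mul, lowerEven, coeff_mk, if_pos (even_two_mul n), mul_left_inj' hs,
    InitialRelation, show 2 * (n : ℤ) = ((2 * n : ℕ) : ℤ) by push_cast; rfl, gammaCoeff_natCast]

omit [CharZero K] in
theorem lower_coeff_two_mul (φ : K⟦X⟧) (R n : ℕ) :
    coeff (2 * n) (X * lowerEven φ R) =
      coeff (2 * n) (2 * evenBernoulliSeries K * lowerOdd φ R) := by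
  have h1 : coeff (2 * n) (X * lowerEven φ R) = 0 := by
    cases n with
    | zero => simp
    | succ n =>
      rw [show 2 * (n + 1) = 2 * n + 1 + 1 by ring, coeff_succ_X_mul]
      simp [lowerEven]
  rw [h1, coeff_two_mul_evenBernoulliSeries_mul]
  refine (Finset.sum_eq_zero fun l hl => ?_).symm
  rw [Finset.mem_range] at hl
  by_cases hev : Even (2 * n - l)
  · have : Even l := by
      simp only [Nat.even_iff] at *
      omega
    simp [lowerOdd, this]
  · rw [coeff_evenBernoulliSeries_of_not_even hev]
    simp

theorem mem_FSpace_iff_relations (φ : K⟦X⟧) {r k : ℤ} (hk : r = 2 * k ∨ r = 2 * k + 1) :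
    φ ∈ FSpace K r ↔
      (∀ n : ℤ, 0 ≤ n → 0 < 2 * n + r → MainRelation φ r k n) ∧
      (Even r → r ≤ 0 → gammaCoeff φ (1 - r) = 0) ∧
      (∀ n : ℤ, 0 ≤ n → 2 * n + r < 0 → InitialRelation φ r n) := by
  rw [mem_FSpace_iff_bernoulli, ← and_assoc]
  refine and_congr ⟨fun H => ⟨fun n _ hn => ?_, fun he _ => ?_⟩, ?_⟩ ⟨fun H n hn hr => ?_, ?_⟩
  · exact (mainRelation_iff φ (s := (2 * n + r - 1).toNat) hk (by omega)).2 (H _)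
  · exact (upper_coeff_zero_iff φ r).1 (H 0) he
  · rintro ⟨H1, H2⟩ s
    cases s with
    | zero =>
      refine (upper_coeff_zero_iff φ r).2 fun he => ?_
      rcases le_or_gt r 0 with h | h
      · exact H2 he h
      · exact gammaCoeff_of_neg φ (by rw [Int.even_iff] at he; omega)
    | succ s =>
      by_cases he : Even ((s : ℤ) + 1 - r)
      · obtain ⟨n, hn⟩ := he
        refine (mainRelation_iff φ (n := n) hk (by omega)).1 ?_
        rcases lt_or_ge n 0 with h | h
        -- For `r > 0` the upper half also contains degrees with `n < 0`; there both sides vanish.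
        · exact mainRelation_of_neg φ h
        · exact H1 n h (by omega)
      · exact upper_coeff_of_not_even φ he
  · lift n to ℕ using hn
    obtain ⟨R, hR⟩ : ∃ R : ℕ, r = -(R : ℤ) := ⟨(-r).toNat, by omega⟩
    have := H R hR (2 * n + 1) (by omega)
    subst hR
    exact (initialRelation_iff φ (by omega)).2 this
  · rintro H R rfl n hn
    rcases Nat.even_or_odd' n with ⟨m, rfl | rfl⟩
    · exact lower_coeff_two_mul φ R m
    · exact (initialRelation_iff φ (by omega)).1 (H m (by omega) (by omega))

end

/-! ### Existence and uniqueness from prescribed coefficients -/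

section

open PowerSeries

variable {K : Type*} [Field K]

theorem existsUnique_of_even_odd_coeffs (e c : ℕ → K) :
    ∃! φ : K⟦X⟧, (∀ n : ℕ, gammaCoeff φ (2 * n) = e n) ∧
      ∀ i : ℕ, gammaCoeff φ (2 * i + 1) = c i := by
  have h0 : ∀ (φ : K⟦X⟧) (n : ℕ), gammaCoeff φ (2 * n) = coeff (2 * n) φ := fun φ n => by
    exact_mod_cast gammaCoeff_natCast φ (2 * n)
  have h1 : ∀ (φ : K⟦X⟧) (n : ℕ), gammaCoeff φ (2 * n + 1) = coeff (2 * n + 1) φ := fun φ n => by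
    exact_mod_cast gammaCoeff_natCast φ (2 * n + 1)
  simp only [h0, h1]
  refine ⟨mk fun m => if Even m then e (m / 2) else c (m / 2), ⟨fun n => ?_, fun i => ?_⟩, ?_⟩
  · simp
  · have : (2 * i + 1) / 2 = i := by omega
    simp [this]
  · rintro φ ⟨H0, H1⟩
    ext m
    rw [coeff_mk]
    rcases Nat.even_or_odd' m with ⟨n, rfl | rfl⟩
    · simp [H0]
    · have : (2 * n + 1) / 2 = n := by omega
      simp [H1, this]

/-- The right-hand side of `MainRelation`. -/
noncomputable def mainValue (φ : K⟦X⟧) (r k n : ℤ) : K :=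
  2 / (2 * (n : K) + (r : K)) *
    ∑ i ∈ Finset.Icc (-k) n,
      (((2 * n + r).toNat.choose (2 * i + r).toNat : ℕ) : K) *
        ((bernoulli (2 * n - 2 * i).toNat : ℚ) : K) * gammaCoeff φ (2 * i + 1)

/-- The right-hand side of `InitialRelation`. -/
noncomputable def initialValue (φ : K⟦X⟧) (r n : ℤ) : K :=
  ∑ i ∈ Finset.Icc 0 n,
    2 / (2 * (i : K) + (r : K)) *
      (((-2 * i - r).toNat.choose (-2 * n - r).toNat : ℕ) : K) *
        ((bernoulli (2 * n - 2 * i).toNat : ℚ) : K) * gammaCoeff φ (2 * i + 1)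

theorem gammaCoeff_odd_congr {φ ψ : K⟦X⟧}
    (h : ∀ i : ℕ, gammaCoeff φ (2 * i + 1) = gammaCoeff ψ (2 * i + 1)) (i : ℤ) :
    gammaCoeff φ (2 * i + 1) = gammaCoeff ψ (2 * i + 1) := by
  rcases lt_or_ge i 0 with hi | hi
  · rw [gammaCoeff_of_neg φ (by omega), gammaCoeff_of_neg ψ (by omega)]
  · lift i to ℕ using hi
    exact h i

theorem mainRelation_iff_of_odd_eq {φ ψ : K⟦X⟧}
    (h : ∀ i : ℕ, gammaCoeff φ (2 * i + 1) = gammaCoeff ψ (2 * i + 1)) (r k n : ℤ) :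
    MainRelation φ r k n ↔ gammaCoeff φ (2 * n) = mainValue ψ r k n := by
  simp only [MainRelation, mainValue, gammaCoeff_odd_congr h]

theorem initialRelation_iff_of_odd_eq {φ ψ : K⟦X⟧}
    (h : ∀ i : ℕ, gammaCoeff φ (2 * i + 1) = gammaCoeff ψ (2 * i + 1)) (r n : ℤ) :
    InitialRelation φ r n ↔ gammaCoeff φ (2 * n) = initialValue ψ r n := by
  simp only [InitialRelation, initialValue, gammaCoeff_odd_congr h]

/-- The sign of `2n + r` decides whether (M_n), (I_n) or the free value `a` fixes `γ_{2n}`. The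
guards `Even r → r ≤ 0` cover all cases at once; otherwise `2n + r = 0` does not occur and `a` plays
no role. -/
theorem existsUnique_mem_FSpace [CharZero K] {r k : ℤ} (hk : r = 2 * k ∨ r = 2 * k + 1)
    (c : ℕ → K) (a : K) (hc : Even r → r ≤ 0 → ∀ i : ℕ, 2 * (i : ℤ) + 1 = 1 - r → c i = 0) :
    ∃! φ : K⟦X⟧, φ ∈ FSpace K r ∧ (∀ i : ℕ, gammaCoeff φ (2 * i + 1) = c i) ∧
      (Even r → r ≤ 0 → gammaCoeff φ (-r) = a) := by
  -- `ψ` only stores the odd coefficients `c`: the right-hand sides of the relations see nothing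
  -- else, so they can be evaluated before `φ` is known.
  obtain ⟨ψ, ⟨-, hψ⟩, -⟩ := existsUnique_of_even_odd_coeffs 0 c
  refine (existsUnique_congr fun φ => ?_).1 (existsUnique_of_even_odd_coeffs
    (fun n => if 0 < 2 * (n : ℤ) + r then mainValue ψ r k n
      else if 2 * (n : ℤ) + r < 0 then initialValue ψ r n else a) c)
  rw [and_left_comm, and_comm]
  refine and_congr_right fun hφ => ?_
  have hodd : ∀ i : ℕ, gammaCoeff φ (2 * i + 1) = gammaCoeff ψ (2 * i + 1) := fun i => by
    rw [hφ, hψ]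
  rw [mem_FSpace_iff_relations φ hk]
  simp only [mainRelation_iff_of_odd_eq hodd, initialRelation_iff_of_odd_eq hodd]
  constructor
  · intro H
    refine ⟨⟨fun n hn h => ?_, fun he hr => ?_, fun n hn h => ?_⟩, fun he hr => ?_⟩
    · lift n to ℕ using hn
      simpa [h] using H n
    · obtain ⟨d, hd⟩ := he
      obtain ⟨i, hi⟩ : ∃ i : ℕ, -d = i := ⟨(-d).toNat, by omega⟩
      rw [show 1 - r = 2 * (i : ℤ) + 1 by omega, hφ]
      exact hc ⟨d, hd⟩ hr i (by omega)
    · lift n to ℕ using hn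
      have := H n
      rwa [if_neg (by omega), if_pos h] at this
    · obtain ⟨d, hd⟩ := he
      obtain ⟨i, hi⟩ : ∃ i : ℕ, -d = i := ⟨(-d).toNat, by omega⟩
      have h0 : 2 * (i : ℤ) + r = 0 := by omega
      rw [show -r = 2 * (i : ℤ) by omega]
      simpa [h0] using H i
  · rintro ⟨⟨H1, -, H3⟩, H4⟩ n
    split_ifs with h h'
    · exact H1 n (by omega) h
    · exact H3 n (by omega) h'
    · rw [show 2 * (n : ℤ) = -r by omega]
      exact H4 ⟨-n, by omega⟩ (by omega)

end

theorem mainTheorem4 (K : Type*) [Field K] [CharZero K] (r k : ℤ) :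
    (r = 2 * k →
      (∀ φ : PowerSeries K, φ ∈ FSpace K r ↔
        (∀ n : ℤ, max 0 (1 - k) ≤ n → MainRelation φ r k n) ∧
        (r ≤ 0 → gammaCoeff φ (1 - r) = 0) ∧
        (r < 0 → ∀ n : ℤ, 0 ≤ n → n ≤ -k - 1 → InitialRelation φ r n)) ∧
      -- for `r > 0` the odd coefficients are arbitrary and determine the even ones
      (0 < r → ∀ c : ℕ → K, ∃! φ : PowerSeries K,
        φ ∈ FSpace K r ∧ ∀ i : ℕ, gammaCoeff φ (2 * i + 1) = c i) ∧
      -- for `r ≤ 0` the odd coefficients are arbitrary up to `γ_{1-r} = 0`, the coefficient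
      -- `γ_{-r}` is unconstrained, and together they determine the other even coefficients
      (r ≤ 0 → ∀ (c : ℕ → K) (a : K), (∀ i : ℕ, 2 * (i : ℤ) + 1 = 1 - r → c i = 0) →
        ∃! φ : PowerSeries K,
          φ ∈ FSpace K r ∧ (∀ i : ℕ, gammaCoeff φ (2 * i + 1) = c i) ∧
            gammaCoeff φ (-r) = a)) ∧
    (r = 2 * k + 1 →
      (∀ φ : PowerSeries K, φ ∈ FSpace K r ↔
        (∀ n : ℤ, max 0 (-k) ≤ n → MainRelation φ r k n) ∧
        (r < 0 → ∀ n : ℤ, 0 ≤ n → n ≤ -k - 1 → InitialRelation φ r n)) ∧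
      -- the odd coefficients are arbitrary and determine the even ones
      (∀ c : ℕ → K, ∃! φ : PowerSeries K,
        φ ∈ FSpace K r ∧ ∀ i : ℕ, gammaCoeff φ (2 * i + 1) = c i)) := by
  refine ⟨fun hr => ?_, fun hr => ?_⟩
  · have he : Even r := ⟨k, by omega⟩
    refine ⟨fun φ => ?_, fun hpos c => ?_, fun hle c a hc => ?_⟩
    · rw [mem_FSpace_iff_relations φ (Or.inl hr)]
      refine and_congr ⟨fun H n hn => H n (by omega) (by omega),
        fun H n hn hn' => H n (by omega)⟩ (and_congr ⟨fun H => H he, fun H _ => H⟩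
        ⟨fun H _ n hn hn' => H n hn (by omega),
          fun H n hn hn' => H (by omega) n hn (by omega)⟩)
    · simpa [he, not_le.mpr hpos] using
        existsUnique_mem_FSpace (Or.inl hr) c 0 (fun _ h => absurd h (not_le.mpr hpos))
    · simpa [he, hle] using existsUnique_mem_FSpace (Or.inl hr) c a (fun _ _ => hc)
  · have he : ¬ Even r := by rw [Int.even_iff]; omega
    refine ⟨fun φ => ?_, fun c => ?_⟩
    · rw [mem_FSpace_iff_relations φ (Or.inr hr)]
      refine and_congr ⟨fun H n hn => H n (by omega) (by omega),
        fun H n hn hn' => H n (by omega)⟩ ⟨fun H _ n hn hn' => H.2 n hn (by omega),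
          fun H => ⟨fun h => absurd h he, fun n hn hn' => H (by omega) n hn (by omega)⟩⟩
    · simpa [he] using existsUnique_mem_FSpace (Or.inr hr) c 0 (fun h => absurd h he)
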